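/- For every $\eta>0$ there is a constant $c=c(\eta)>0$ such that the following holds. Let $A$ be a real number and let $d:\mathbb N\to\mathbb N$ satisfy $d(n)=o(n)$. Then there is $n_0$ (depending on $\eta$, $A$ and $d$) such that for all $n\ge n_0$ and all $\varepsilon$ with $2^{-An}\le\varepsilon\le 1-\eta$, every randomized algorithm that takes $m$ i.i.d. samples from an unknown, arbitrary distribution $P$ on $\{0,1\}^n$, and that answers "yes" with probability at least $2/3$ whenever $P$ is a degree-$d(n)$ Bayes net, and "no" with probability at least $2/3$ whenever $P$ is $\varepsilon$-far from every degree-$d(n)$ Bayes net, must use $$m\;\ge\; c\cdot\frac{2^{n/2}}{\varepsilon^2}$$ samples. Here a distribution $P$ on $\{0,1\}^n$ is a degree-$d$ Bayes net if there are a directed acyclic graph $G$ on $\{1,\dots,n\}$ in which every node $i$ has a set $\Pi_i$ of at most $d$ parents, and probability distributions $p_{i,\pi}$ on $\{0,1\}$ for each node $i$ and each $\pi\in\{0,1\}^{\Pi_i}$, such that $P(x)=\prod_{i=1}^n p_{i,x_{\Pi_i}}(x_i)$ for all $x\in\{0,1\}^n$. $P$ is $\varepsilon$-far from $Q$ if $d_{\mathrm{TV}}(P,Q)=\frac12\sum_{x\in\{0,1\}^n}|P(x)-Q(x)|\ge\varepsilon$.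 -/

import Mathlib

open Filter Asymptotics

noncomputable section

/-- The Boolean hypercube `{0,1}^n`. -/
abbrev Cube (n : ℕ) : Type := Fin n → Bool

/-- A directed graph is acyclic if no vertex can be reached from itself by a directed walk of
positive length. -/
def IsDAG {n : ℕ} (G : Digraph (Fin n)) : Prop :=
  ∀ v, ¬ Relation.TransGen G.Adj v v

/-- The parents of a node `i`: the sources of the arrows that point to `i`. -/
def parents {n : ℕ} (G : Digraph (Fin n)) (i : Fin n) : Set (Fin n) :=
  {j | G.Adj j i}

/-- `P` is Markov with respect to `G`: there are distributions `p i π` on `{0,1}`, one for each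
node `i` and each assignment `π` of bits to the parents of `i`, such that
`P x = ∏ i, p i (x restricted to the parents of i) (x i)`. -/
def IsMarkov {n : ℕ} (G : Digraph (Fin n)) (P : PMF (Cube n)) : Prop :=
  ∃ p : (i : Fin n) → (parents G i → Bool) → PMF Bool,
    ∀ x : Cube n, P x = ∏ i, p i (fun j => x j) (x i)

/-- `P` is a degree-`d` Bayes net: it is Markov with respect to some directed acyclic graph
in which every node has at most `d` parents. -/
def IsBayesNet {n : ℕ} (d : ℕ) (P : PMF (Cube n)) : Prop :=
  ∃ G : Digraph (Fin n), IsDAG G ∧ (∀ i, (parents G i).ncard ≤ d) ∧ IsMarkov G P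

/-- Total variation distance of two distributions on a finite set. -/
def tvDist {α : Type*} [Fintype α] (P Q : PMF α) : ℝ :=
  (1 / 2) * ∑ x, |(P x).toReal - (Q x).toReal|

/-- `P` is `ε`-far (in total variation distance) from every degree-`d` Bayes net. -/
def IsFarFromBayesNets {n : ℕ} (d : ℕ) (ε : ℝ) (P : PMF (Cube n)) : Prop :=
  ∀ Q : PMF (Cube n), IsBayesNet d Q → ε ≤ tvDist P Q

/-- The law of `m` i.i.d. samples from `P`. -/
def iidSamples {α : Type*} [Fintype α] (P : PMF α) (m : ℕ) : PMF (Fin m → α) :=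
  PMF.ofFintype (fun s => ∏ i, P (s i)) (by
    classical
    have h : ∑ x, P x = 1 := by rw [← tsum_fintype (L := .unconditional _)]; exact P.tsum_coe
    rw [← Fintype.piFinset_univ, Finset.sum_prod_piFinset]
    simp [h])

/-- The law of the output of a randomized algorithm `T` that is run on `m` i.i.d. samples from
`P`. For each tuple `s` of samples, `T s` is the law of the answer of the algorithm (over its
internal randomness). -/
def outputLaw {α : Type*} [Fintype α] {m : ℕ} (T : (Fin m → α) → PMF Bool) (P : PMF α) :
    PMF Bool :=
  (iidSamples P m).bind T

/-- The randomized `m`-sample algorithm `T` tests whether an arbitrary distribution on `{0,1}^n` is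
a degree-`d` Bayes net (answer `true`) or is `ε`-far from every degree-`d` Bayes net
(answer `false`), with probability of success at least `2/3` in either case. -/
def IsBayesNetTester {n m : ℕ} (d : ℕ) (ε : ℝ) (T : (Fin m → Cube n) → PMF Bool) : Prop :=
  ∀ P : PMF (Cube n),
    (IsBayesNet d P → 2 / 3 ≤ (outputLaw T P true).toReal) ∧
    (IsFarFromBayesNets d ε P → 2 / 3 ≤ (outputLaw T P false).toReal)

end

/-!
Split the `n` coordinates into `n - k` and `k`, where `k` depends on `η` only. For a uniformly
random `z : {0,1}^(n-k) → {0,1}^k`, let `P z` be the mixture of the uniform distribution on the cube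
with the uniform distribution on the graph of `z`, the latter with a weight `a` slightly above `ε`.

* The total variation distance from `P z` to a fixed distribution is a sum of `2^(n-k)` independent
  bounded terms whose mean exceeds `ε`, so by Hoeffding's inequality it is below `ε` only with
  probability `exp (-Ω(2^n))`. A union bound over a net of the degree-`d` Bayes nets, which has only
  `exp (2^(o(n)))` elements, shows that `P z` is `ε`-far from all of them with high probability.
* The uniform distribution is a Bayes net. By Ingster's second moment method `m` samples do not
  distinguish it from a random `P z` unless `E (corr z z')^m` is bounded away from `1`. As the
  correlation is again a sum of `2^(n-k)` independent bounded terms, this moment is at most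
  `exp (O(m^2 ε^4 / 2^n))`.
-/

noncomputable section

open MeasureTheory ProbabilityTheory

section UniformProduct

instance isProbabilityMeasure_uniformOn_univ {Ω : Type*} [Finite Ω] [Nonempty Ω]
    [MeasurableSpace Ω] [MeasurableSingletonClass Ω] :
    IsProbabilityMeasure (uniformOn (Set.univ : Set Ω)) :=
  isProbabilityMeasure_uniformOn Set.finite_univ Set.univ_nonempty

lemma integral_uniformOn_univ {κ : Type*} [Fintype κ] [MeasurableSpace κ]
    [MeasurableSingletonClass κ] (f : κ → ℝ) :
    ∫ v, f v ∂uniformOn Set.univ = (∑ v, f v) / Fintype.card κ := by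
  rw [uniformOn, ProbabilityTheory.cond, integral_smul_measure, Measure.restrict_univ,
    integral_count]
  simp [div_eq_inv_mul]

lemma hasSubgaussianMGF_sum_eval {ι : Type*} [Fintype ι] {Ω : ι → Type*}
    [∀ i, MeasurableSpace (Ω i)] {ν : ∀ i, Measure (Ω i)} [∀ i, IsProbabilityMeasure (ν i)]
    {f : ∀ i, Ω i → ℝ} (hf : ∀ i, Measurable (f i)) {lo hi : ι → ℝ}
    (hmem : ∀ i ω, f i ω ∈ Set.Icc (lo i) (hi i)) :
    HasSubgaussianMGF (fun ω ↦ ∑ i, (f i (ω i) - ∫ x, f i x ∂ν i))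
      (∑ i, (‖hi i - lo i‖₊ / 2) ^ 2) (Measure.pi ν) := by
  refine HasSubgaussianMGF.sum_of_iIndepFun
    (iIndepFun_pi (X := fun i x ↦ f i x - ∫ x, f i x ∂ν i)
      fun i ↦ ((hf i).sub_const _).aemeasurable) fun i _ ↦ ?_
  refine HasSubgaussianMGF.of_map (X := fun x ↦ f i x - ∫ x, f i x ∂ν i)
    (measurable_pi_apply i).aemeasurable ?_
  rw [(measurePreserving_eval ν i).map_eq]
  exact hasSubgaussianMGF_of_mem_Icc (hf i).aemeasurable (.of_forall (hmem i))

lemma hasSubgaussianMGF_sum_uniformOn {ι κ : Type*} [Fintype ι] [Fintype κ] [Nonempty κ]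
    [MeasurableSpace κ] [MeasurableSingletonClass κ] {f : ι → κ → ℝ} {lo : ι → ℝ} {r : ℝ}
    (hmem : ∀ i v, f i v ∈ Set.Icc (lo i) (lo i + r)) :
    HasSubgaussianMGF (fun z ↦ ∑ i, (f i (z i) - (∑ v, f i v) / Fintype.card κ))
      (Fintype.card ι * (‖r‖₊ / 2) ^ 2) (uniformOn (Set.univ : Set (ι → κ))) := by
  rw [← Set.pi_univ Set.univ, uniformOn_pi]
  simpa [integral_uniformOn_univ] using
    hasSubgaussianMGF_sum_eval (ν := fun _ ↦ uniformOn Set.univ)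
      (fun i ↦ measurable_of_finite (f i)) hmem

end UniformProduct

section TotalVariation

variable {α : Type*} [Fintype α]

lemma sum_toReal_pmf (P : PMF α) : ∑ x, (P x).toReal = 1 := by
  rw [← ENNReal.toReal_sum fun x _ ↦ P.apply_ne_top x, ← tsum_fintype (L := .unconditional _),
    P.tsum_coe, ENNReal.toReal_one]

lemma tvDist_triangle (P Q R : PMF α) : tvDist P R ≤ tvDist P Q + tvDist Q R := by
  unfold tvDist
  rw [← mul_add, ← Finset.sum_add_distrib]
  gcongr with x
  exact abs_sub_le _ _ _

lemma tvDist_eq_sum_posPart (P Q : PMF α) :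
    tvDist P Q = ∑ x, ((P x).toReal - (Q x).toReal)⁺ := by
  have habs (x : α) : |(P x).toReal - (Q x).toReal| =
      2 * ((P x).toReal - (Q x).toReal)⁺ - ((P x).toReal - (Q x).toReal) := by
    rw [eq_sub_iff_add_eq, abs_add_eq_two_nsmul_posPart, nsmul_eq_mul, Nat.cast_two]
  simp_rw [tvDist, habs, Finset.sum_sub_distrib, sum_toReal_pmf, ← Finset.mul_sum]
  ring

end TotalVariation

section SecondMoment

variable {α : Type*} [Fintype α] {m : ℕ}

lemma toReal_iidSamples (P : PMF α) (s : Fin m → α) :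
    (iidSamples P m s).toReal = ∏ i, (P (s i)).toReal := by
  rw [iidSamples, PMF.ofFintype_apply, ENNReal.toReal_prod]

lemma toReal_outputLaw (T : (Fin m → α) → PMF Bool) (P : PMF α) (b : Bool) :
    (outputLaw T P b).toReal = ∑ s, (iidSamples P m s).toReal * (T s b).toReal := by
  rw [outputLaw, PMF.bind_apply, tsum_fintype, ENNReal.toReal_sum
    fun s _ ↦ ENNReal.mul_ne_top (PMF.apply_ne_top _ _) (PMF.apply_ne_top _ _)]
  simp_rw [ENNReal.toReal_mul]

lemma toReal_pmf_le_one {β : Type*} (P : PMF β) (x : β) : (P x).toReal ≤ 1 :=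
  ENNReal.toReal_mono ENNReal.one_ne_top (P.coe_le_one x)

lemma sq_sum_mul_sub_one_mul_le {ι : Type*} [Fintype ι] {w W g : ι → ℝ} (hw : ∀ s, 0 ≤ w s)
    (hw_sum : ∑ s, w s = 1) (hwW_sum : ∑ s, w s * W s = 1) (hg0 : ∀ s, 0 ≤ g s)
    (hg1 : ∀ s, g s ≤ 1) :
    (∑ s, w s * (W s - 1) * g s) ^ 2 ≤ ∑ s, w s * W s ^ 2 - 1 := by
  have hvar : ∑ s, w s * (W s - 1) ^ 2 = ∑ s, w s * W s ^ 2 - 1 := by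
    have hexpand (s : ι) : w s * (W s - 1) ^ 2 = w s * W s ^ 2 - 2 * (w s * W s) + w s := by ring
    simp_rw [hexpand, Finset.sum_add_distrib, Finset.sum_sub_distrib, ← Finset.mul_sum, hwW_sum,
      hw_sum]
    ring
  have hg_sum : ∑ s, w s * g s ^ 2 ≤ 1 := hw_sum ▸ Finset.sum_le_sum fun s _ ↦
    mul_le_of_le_one_right (hw s) (pow_le_one₀ (hg0 s) (hg1 s))
  calc (∑ s, w s * (W s - 1) * g s) ^ 2
      ≤ (∑ s, w s * (W s - 1) ^ 2) * ∑ s, w s * g s ^ 2 :=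
        Finset.sum_sq_le_sum_mul_sum_of_sq_le_mul _ (fun s _ ↦ mul_nonneg (hw s) (sq_nonneg _))
          (fun s _ ↦ mul_nonneg (hw s) (sq_nonneg _)) fun s _ ↦ by ring_nf; rfl
    _ ≤ ∑ s, w s * W s ^ 2 - 1 := by
        rw [← hvar]
        exact mul_le_of_le_one_right
          (Finset.sum_nonneg fun s _ ↦ mul_nonneg (hw s) (sq_nonneg _)) hg_sum

variable {Z : Type*} [Finite Z] [MeasurableSpace Z] [MeasurableSingletonClass Z]
  {μ : Measure Z} [IsProbabilityMeasure μ] {Q : PMF α} {P : Z → PMF α} {φ : Z → α → ℝ}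

lemma sum_iidSamples_mul_integral_prod (hφ : ∀ z x, (P z x).toReal = (Q x).toReal * φ z x) :
    ∑ s, (iidSamples Q m s).toReal * ∫ z, ∏ i, φ z (s i) ∂μ = 1 := by
  simp_rw [← integral_const_mul, toReal_iidSamples, ← Finset.prod_mul_distrib, ← hφ,
    ← toReal_iidSamples]
  rw [← integral_finsetSum _ fun _ _ ↦ .of_finite]
  simp [sum_toReal_pmf]

lemma sum_iidSamples_mul_sq_integral_prod :
    ∑ s, (iidSamples Q m s).toReal * (∫ z, ∏ i, φ z (s i) ∂μ) ^ 2 =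
      ∫ z', ∫ z, (∑ x, (Q x).toReal * (φ z x * φ z' x)) ^ m ∂μ ∂μ := by
  simp_rw [sq, ← integral_const_mul, ← integral_mul_const, ← integral_const_mul,
    Fintype.sum_pow, toReal_iidSamples, Finset.prod_mul_distrib]
  rw [← integral_finsetSum _ fun _ _ ↦ .of_finite]
  refine integral_congr_ae (.of_forall fun z' ↦ ?_)
  exact (integral_finsetSum _ fun _ _ ↦ .of_finite).symm

/-- **Ingster's method**: Cauchy–Schwarz against the likelihood ratio of the average of `P z`. -/
theorem sq_integral_outputLaw_sub_le (hφ : ∀ z x, (P z x).toReal = (Q x).toReal * φ z x)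
    (T : (Fin m → α) → PMF Bool) (b : Bool) :
    (∫ z, (outputLaw T (P z) b).toReal ∂μ - (outputLaw T Q b).toReal) ^ 2 ≤
      ∫ z', ∫ z, (∑ x, (Q x).toReal * (φ z x * φ z' x)) ^ m ∂μ ∂μ - 1 := by
  have hadv : ∫ z, (outputLaw T (P z) b).toReal ∂μ - (outputLaw T Q b).toReal =
      ∑ s, (iidSamples Q m s).toReal * (∫ z, ∏ i, φ z (s i) ∂μ - 1) * (T s b).toReal := by
    simp_rw [toReal_outputLaw]
    rw [integral_finsetSum _ fun _ _ ↦ .of_finite, ← Finset.sum_sub_distrib]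
    refine Finset.sum_congr rfl fun s _ ↦ ?_
    simp_rw [integral_mul_const, toReal_iidSamples, hφ, Finset.prod_mul_distrib,
      integral_const_mul]
    ring
  rw [hadv, ← sum_iidSamples_mul_sq_integral_prod]
  exact sq_sum_mul_sub_one_mul_le (fun _ ↦ ENNReal.toReal_nonneg) (sum_toReal_pmf _)
    (sum_iidSamples_mul_integral_prod hφ) (fun _ ↦ ENNReal.toReal_nonneg)
    fun _ ↦ toReal_pmf_le_one _ _

lemma toReal_pmf_bool_add (p : PMF Bool) : (p true).toReal + (p false).toReal = 1 := by
  simpa using sum_toReal_pmf p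

theorem le_integral_pow_of_distinguishes
    (hφ : ∀ z x, (P z x).toReal = (Q x).toReal * φ z x) {T : (Fin m → α) → PMF Bool}
    (hQ : 2 / 3 ≤ (outputLaw T Q true).toReal)
    (hP : 3 / 4 ≤ μ.real {z | 2 / 3 ≤ (outputLaw T (P z) false).toReal}) :
    37 / 36 ≤ ∫ z', ∫ z, (∑ x, (Q x).toReal * (φ z x * φ z' x)) ^ m ∂μ ∂μ := by
  have hreject : 1 / 2 ≤ ∫ z, (outputLaw T (P z) false).toReal ∂μ := by
    linarith [mul_meas_ge_le_integral_of_nonneg (μ := μ)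
      (.of_forall fun z ↦ ENNReal.toReal_nonneg (a := outputLaw T (P z) false)) .of_finite (2 / 3)]
  have hadv : (1 / 6 : ℝ) ≤
      ∫ z, (outputLaw T (P z) false).toReal ∂μ - (outputLaw T Q false).toReal := by
    linarith [toReal_pmf_bool_add (outputLaw T Q)]
  nlinarith [sq_integral_outputLaw_sub_le (μ := μ) hφ T false]

end SecondMoment

section Planted

variable {ι κ : Type*} [Fintype κ]

theorem measureReal_sum_le_sub_le [Fintype ι] [MeasurableSpace κ] [MeasurableSingletonClass κ]
    [Nonempty κ] {f : ι → κ → ℝ} {lo : ι → ℝ} {r : ℝ}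
    (hmem : ∀ i v, f i v ∈ Set.Icc (lo i) (lo i + r)) {t : ℝ} (ht : 0 ≤ t) :
    (uniformOn (Set.univ : Set (ι → κ))).real
        {z | ∑ i, f i (z i) ≤ ∑ i, (∑ v, f i v) / Fintype.card κ - t} ≤
      Real.exp (-2 * t ^ 2 / (Fintype.card ι * r ^ 2)) := by
  have hevent : {z : ι → κ | ∑ i, f i (z i) ≤ ∑ i, (∑ v, f i v) / Fintype.card κ - t} =
      {z | t ≤ (-fun z : ι → κ ↦ ∑ i, (f i (z i) - (∑ v, f i v) / Fintype.card κ)) z} := by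
    ext z
    simp only [Set.mem_ofPred_eq, Pi.neg_apply, Finset.sum_sub_distrib]
    constructor <;> intro h <;> linarith
  rw [hevent]
  refine ((hasSubgaussianMGF_sum_uniformOn hmem).neg.measure_ge_le ht).trans_eq ?_
  congr 1
  simp only [NNReal.coe_mul, NNReal.coe_pow, NNReal.coe_div, NNReal.coe_natCast, coe_nnnorm,
    NNReal.coe_ofNat, Real.norm_eq_abs, div_pow, sq_abs]
  rw [show 2 * (Fintype.card ι * (r ^ 2 / 2 ^ 2)) = Fintype.card ι * r ^ 2 / 2 by ring,
    div_div_eq_mul_div]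
  ring

lemma posPart_add_sub_posPart_mem_Icc (x : ℝ) {r : ℝ} (hr : 0 ≤ r) :
    (x + r)⁺ - x⁺ ∈ Set.Icc 0 r := by
  rw [Set.mem_Icc, sub_nonneg, sub_le_iff_le_add']
  exact ⟨posPart_mono (by linarith), max_le (by gcongr; exact le_posPart x) (by positivity)⟩

/-- Even the distribution that overlaps best with every `plantedPMF e a z` on average misses a
fraction `1 - 1 / #κ` of the planted mass. -/
lemma le_average_tvDist_plantedPMF [Fintype ι] [Nonempty ι] [Nonempty κ] {q : ι → κ → ℝ}
    (hq : ∑ i, ∑ v, q i v = 1) {a c : ℝ}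
    (hc : c = (1 - a) / (Fintype.card ι * Fintype.card κ)) :
    a * (1 - 1 / Fintype.card κ) ≤
      ∑ i, ∑ v, (c - q i v)⁺ +
        ∑ i, (∑ v, ((c - q i v + a / Fintype.card ι)⁺ - (c - q i v)⁺)) / Fintype.card κ := by
  have hK : (1 : ℝ) / Fintype.card κ ≤ 1 := by
    rw [div_le_one (by positivity)]
    exact_mod_cast Fintype.card_pos
  have hterm (i : ι) (v : κ) : (c - q i v + a / Fintype.card ι) / Fintype.card κ ≤
      (c - q i v)⁺ + ((c - q i v + a / Fintype.card ι)⁺ - (c - q i v)⁺) / Fintype.card κ := by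
    have := le_posPart (c - q i v + a / Fintype.card ι)
    have := mul_nonneg (sub_nonneg.2 hK) (posPart_nonneg (c - q i v))
    have : (c - q i v + a / Fintype.card ι) / Fintype.card κ ≤
      (c - q i v + a / Fintype.card ι)⁺ / Fintype.card κ := by gcongr
    rw [sub_div]
    linarith [div_eq_mul_one_div ((c - q i v)⁺) (Fintype.card κ : ℝ)]
  calc a * (1 - 1 / Fintype.card κ)
      = ∑ i, ∑ v, (c - q i v + a / Fintype.card ι) / Fintype.card κ := by
        simp_rw [← Finset.sum_div, Finset.sum_add_distrib, Finset.sum_sub_distrib, hq,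
          Finset.sum_const, Finset.card_univ, nsmul_eq_mul, hc]
        field_simp
        ring
    _ ≤ _ := by
        simp_rw [Finset.sum_div, ← Finset.sum_add_distrib]
        gcongr with i _ v
        exact hterm i v

variable [DecidableEq κ]

/-- The density, relative to the uniform distribution on `ι × κ`, of the mixture that follows the
uniform distribution with probability `1 - a` and the uniform distribution on the graph of `z`
with probability `a`. -/
def plantedDensity (a : ℝ) (z : ι → κ) (y : ι × κ) : ℝ :=
  1 - a + if y.2 = z y.1 then a * Fintype.card κ else 0

lemma plantedDensity_nonneg (a : unitInterval) (z : ι → κ) (y : ι × κ) :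
    0 ≤ plantedDensity a z y := by
  have := unitInterval.nonneg a
  have := unitInterval.one_minus_nonneg a
  unfold plantedDensity
  positivity

variable [Fintype ι]

lemma sum_plantedDensity (a : ℝ) (z : ι → κ) :
    ∑ y, plantedDensity a z y = Fintype.card ι * Fintype.card κ := by
  simp_rw [plantedDensity, Fintype.sum_prod_type, Finset.sum_add_distrib, Finset.sum_ite_eq',
    Finset.mem_univ, if_true, Finset.sum_const, Finset.card_univ, nsmul_eq_mul]
  ring

variable [Nonempty ι] [Nonempty κ]

lemma correlation_plantedDensity (a : ℝ) (z z' : ι → κ) :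
    (∑ y, plantedDensity a z y * plantedDensity a z' y) / (Fintype.card ι * Fintype.card κ) =
      a ^ 2 * Fintype.card κ / Fintype.card ι *
        ∑ i, ((if z i = z' i then (1 : ℝ) else 0) - 1 / Fintype.card κ) + 1 := by
  have hrow (i : ι) : ∑ v, plantedDensity a z (i, v) * plantedDensity a z' (i, v) =
      Fintype.card κ + a ^ 2 * Fintype.card κ ^ 2 *
        ((if z i = z' i then (1 : ℝ) else 0) - 1 / Fintype.card κ) := by
    simp_rw [plantedDensity, add_mul, mul_add, Finset.sum_add_distrib, mul_ite, ite_mul,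
      zero_mul, mul_zero, Finset.sum_ite_eq', Finset.mem_univ, if_true, Finset.sum_const,
      Finset.card_univ, nsmul_eq_mul, ite_self, Finset.sum_ite_eq', Finset.mem_univ, if_true,
      eq_comm (a := z' i)]
    split_ifs <;> field_simp <;> ring
  simp_rw [Fintype.sum_prod_type, hrow, Finset.sum_add_distrib, ← Finset.mul_sum,
    Finset.sum_const, Finset.card_univ, nsmul_eq_mul]
  field_simp
  ring

variable {α : Type*} [Fintype α] (e : α ≃ ι × κ)

/-- The distribution on `α ≃ ι × κ` with density `plantedDensity a z`. For `κ` large it looks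
uniform to few samples, but it is far from any fixed distribution for most functions `z`. -/
def plantedPMF (a : unitInterval) (z : ι → κ) : PMF α :=
  PMF.ofFintype
    (fun x ↦ .ofReal (plantedDensity a z (e x) / (Fintype.card ι * Fintype.card κ))) <| by
    rw [← ENNReal.ofReal_sum_of_nonneg
      fun x _ ↦ div_nonneg (plantedDensity_nonneg a z _) (by positivity), ← Finset.sum_div,
      e.sum_comp (plantedDensity (a : ℝ) z), sum_plantedDensity, div_self (by positivity),
      ENNReal.ofReal_one]

lemma toReal_plantedPMF (a : unitInterval) (z : ι → κ) (x : α) :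
    (plantedPMF e a z x).toReal =
      plantedDensity a z (e x) / (Fintype.card ι * Fintype.card κ) :=
  ENNReal.toReal_ofReal (div_nonneg (plantedDensity_nonneg a z _) (by positivity))

lemma tvDist_plantedPMF (a : unitInterval) (z : ι → κ) (Q : PMF α) {c : ℝ}
    (hc : c = (1 - a) / (Fintype.card ι * Fintype.card κ)) :
    tvDist (plantedPMF e a z) Q =
      ∑ i, (∑ v, (c - (Q (e.symm (i, v))).toReal)⁺ +
        ((c + a / Fintype.card ι - (Q (e.symm (i, z i))).toReal)⁺ -
          (c - (Q (e.symm (i, z i))).toReal)⁺)) := by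
  rw [tvDist_eq_sum_posPart, ← e.symm.sum_comp, Fintype.sum_prod_type]
  refine Finset.sum_congr rfl fun i _ ↦ ?_
  rw [← sub_eq_iff_eq_add', ← Finset.sum_sub_distrib, Finset.sum_eq_single (z i)]
  · rw [toReal_plantedPMF, e.apply_symm_apply, plantedDensity, if_pos rfl, add_div, hc]
    field_simp
  · intro v _ hv
    rw [toReal_plantedPMF, e.apply_symm_apply, plantedDensity, if_neg hv, add_zero, ← hc,
      sub_self]
  · simp

variable [MeasurableSpace κ] [MeasurableSingletonClass κ]

theorem measureReal_tvDist_plantedPMF_le (a : unitInterval) (ha : 0 < a) (Q : PMF α) {τ : ℝ}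
    (hτ : 0 ≤ τ) :
    (uniformOn (Set.univ : Set (ι → κ))).real
        {z | tvDist (plantedPMF e a z) Q ≤ a * (1 - 1 / Fintype.card κ - τ)} ≤
      Real.exp (-2 * τ ^ 2 * Fintype.card ι) := by
  have ha' : (0 : ℝ) < a := ha
  set c : ℝ := (1 - a) / (Fintype.card ι * Fintype.card κ) with hc
  set q : ι → κ → ℝ := fun i v ↦ (Q (e.symm (i, v))).toReal
  have hq : ∑ i, ∑ v, q i v = 1 := by
    rw [← sum_toReal_pmf Q, ← e.symm.sum_comp, Fintype.sum_prod_type]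
  have hmem (i : ι) (v : κ) : (c - q i v + a / Fintype.card ι)⁺ - (c - q i v)⁺ ∈
      Set.Icc (0 : ℝ) (0 + a / Fintype.card ι) := by
    rw [zero_add]
    exact posPart_add_sub_posPart_mem_Icc _ (by positivity)
  calc _ ≤ _ := measureReal_mono fun z hz ↦ ?_
    _ ≤ Real.exp (-2 * (a * τ) ^ 2 / (Fintype.card ι * (a / Fintype.card ι) ^ 2)) :=
        measureReal_sum_le_sub_le hmem (by positivity)
    _ = _ := by
        congr 1
        field_simp
  have hmean := le_average_tvDist_plantedPMF hq hc
  have htv := tvDist_plantedPMF e a z Q hc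
  simp only [add_sub_right_comm, Finset.sum_add_distrib] at htv
  simp only [Set.mem_ofPred_eq, htv] at hz ⊢
  linarith

theorem integral_pow_correlation_le (a : unitInterval) (m : ℕ) (z' : ι → κ) :
    ∫ z, ((∑ y : ι × κ, plantedDensity a z y * plantedDensity a z' y) /
        (Fintype.card ι * Fintype.card κ)) ^ m ∂uniformOn Set.univ ≤
      Real.exp (m ^ 2 * a ^ 4 * Fintype.card κ ^ 2 / (8 * Fintype.card ι)) := by
  set X : (ι → κ) → ℝ := fun z ↦
    ∑ i, ((if z i = z' i then (1 : ℝ) else 0) - 1 / Fintype.card κ) with hX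
  set t : ℝ := m * (a ^ 2 * Fintype.card κ / Fintype.card ι) with ht
  have hpow (z : ι → κ) : ((∑ y : ι × κ, plantedDensity a z y * plantedDensity a z' y) /
      (Fintype.card ι * Fintype.card κ)) ^ m ≤ Real.exp (t * X z) := by
    have hnonneg : 0 ≤ (∑ y : ι × κ, plantedDensity a z y * plantedDensity a z' y) /
        (Fintype.card ι * Fintype.card κ : ℝ) :=
      div_nonneg (Finset.sum_nonneg fun y _ ↦
        mul_nonneg (plantedDensity_nonneg a z y) (plantedDensity_nonneg a z' y)) (by positivity)
    rw [ht, mul_assoc, Real.exp_nat_mul]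
    gcongr
    rw [correlation_plantedDensity]
    exact Real.add_one_le_exp _
  have hmgf : HasSubgaussianMGF X (Fintype.card ι * (‖(1 : ℝ)‖₊ / 2) ^ 2)
      (uniformOn Set.univ) := by
    have hmem (i : ι) (v : κ) : (if v = z' i then (1 : ℝ) else 0) ∈ Set.Icc (0 : ℝ) (0 + 1) := by
      split_ifs <;> simp
    simpa [hX] using hasSubgaussianMGF_sum_uniformOn hmem
  calc _ ≤ ∫ z, Real.exp (t * X z) ∂uniformOn Set.univ :=
        integral_mono .of_finite .of_finite hpow
    _ ≤ _ := hmgf.mgf_le t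
    _ = _ := by
        congr 1
        simp only [ht, nnnorm_one, NNReal.coe_mul, NNReal.coe_natCast, NNReal.coe_pow,
          NNReal.coe_div, NNReal.coe_one, NNReal.coe_ofNat]
        field_simp
        ring

theorem card_le_of_distinguishes {m : ℕ} {T : (Fin m → α) → PMF Bool} [Nonempty α]
    (a : unitInterval)
    (huniform : 2 / 3 ≤ (outputLaw T (PMF.uniformOfFintype α) true).toReal)
    (hplanted : 3 / 4 ≤ (uniformOn (Set.univ : Set (ι → κ))).real
      {z | 2 / 3 ≤ (outputLaw T (plantedPMF e a z) false).toReal}) :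
    (Fintype.card ι : ℝ) ≤ 5 * m ^ 2 * a ^ 4 * Fintype.card κ ^ 2 := by
  have hcard : Fintype.card α = Fintype.card ι * Fintype.card κ := by
    rw [Fintype.card_congr e, Fintype.card_prod]
  have hφ (z : ι → κ) (x : α) : (plantedPMF e a z x).toReal =
      (PMF.uniformOfFintype α x).toReal * plantedDensity a z (e x) := by
    rw [toReal_plantedPMF, PMF.uniformOfFintype_apply, hcard]
    simp [div_eq_inv_mul]
  set E : ℝ := m ^ 2 * a ^ 4 * Fintype.card κ ^ 2 / (8 * Fintype.card ι) with hE
  have hmoment : 37 / 36 ≤ Real.exp E := by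
    refine (le_integral_pow_of_distinguishes hφ huniform hplanted).trans ?_
    have hcorr (z z' : ι → κ) : ∑ x, (PMF.uniformOfFintype α x).toReal *
        (plantedDensity a z (e x) * plantedDensity a z' (e x)) =
        (∑ y, plantedDensity a z y * plantedDensity a z' y) /
          (Fintype.card ι * Fintype.card κ) := by
      simp_rw [PMF.uniformOfFintype_apply, ← Finset.mul_sum,
        e.sum_comp fun y ↦ plantedDensity (a : ℝ) z y * plantedDensity (a : ℝ) z' y, hcard]
      simp [div_eq_inv_mul]
    simp_rw [hcorr]
    refine (integral_mono .of_finite .of_finite (integral_pow_correlation_le a m)).trans_eq ?_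
    simp [hE]
  have hE' : 1 / 37 ≤ E := by
    have hinv : Real.exp (-E) ≤ (37 / 36)⁻¹ := Real.exp_neg E ▸ inv_anti₀ (by norm_num) hmoment
    linarith [Real.one_sub_le_exp_neg E]
  rw [hE, le_div_iff₀ (by positivity)] at hE'
  linarith

end Planted

section Net

lemma norm_prod_sub_prod_le {R ι : Type*} [NormedCommRing R] [NormOneClass R] {s : Finset ι}
    {f g : ι → R} (hf : ∀ i ∈ s, ‖f i‖ ≤ 1) (hg : ∀ i ∈ s, ‖g i‖ ≤ 1) :
    ‖∏ i ∈ s, f i - ∏ i ∈ s, g i‖ ≤ ∑ i ∈ s, ‖f i - g i‖ := by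
  classical
  induction s using Finset.induction_on with
  | empty => simp
  | insert i s hi ih =>
    have ih := ih (fun j hj ↦ hf j (Finset.mem_insert_of_mem hj))
      fun j hj ↦ hg j (Finset.mem_insert_of_mem hj)
    have hg_prod : ‖∏ j ∈ s, g j‖ ≤ 1 := (Finset.norm_prod_le s g).trans <|
      Finset.prod_le_one (fun _ _ ↦ norm_nonneg _) fun j hj ↦ hg j (Finset.mem_insert_of_mem hj)
    rw [Finset.prod_insert hi, Finset.prod_insert hi, Finset.sum_insert hi, add_comm]
    calc ‖f i * ∏ j ∈ s, f j - g i * ∏ j ∈ s, g j‖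
        = ‖f i * (∏ j ∈ s, f j - ∏ j ∈ s, g j) + (f i - g i) * ∏ j ∈ s, g j‖ := by
          congr 1
          ring
      _ ≤ ‖f i‖ * ‖∏ j ∈ s, f j - ∏ j ∈ s, g j‖ + ‖f i - g i‖ * ‖∏ j ∈ s, g j‖ :=
          (norm_add_le _ _).trans <| add_le_add (norm_mul_le _ _) (norm_mul_le _ _)
      _ ≤ ∑ j ∈ s, ‖f j - g j‖ + ‖f i - g i‖ :=
          add_le_add ((mul_le_of_le_one_left (norm_nonneg _)
            (hf i (Finset.mem_insert_self i s))).trans ih)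
            (mul_le_of_le_one_right (norm_nonneg _) hg_prod)

lemma exists_abs_sub_div_le {M : ℕ} (hM : 0 < M) {p : ℝ} (hp : p ∈ Set.Icc 0 1) :
    ∃ t : Fin (M + 1), |p - (t : ℕ) / M| ≤ 1 / M := by
  have hM' : (0 : ℝ) < M := Nat.cast_pos.2 hM
  have hpM : 0 ≤ p * M := mul_nonneg hp.1 hM'.le
  refine ⟨⟨⌊p * M⌋₊, Nat.lt_succ_of_le (Nat.floor_le_of_le
    (mul_le_of_le_one_left hM'.le hp.2))⟩, ?_⟩
  have hsub : p - ⌊p * M⌋₊ / M = (p * M - ⌊p * M⌋₊) / M := by field_simp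
  rw [hsub, abs_div, abs_of_pos hM', abs_of_nonneg (sub_nonneg.2 (Nat.floor_le hpM))]
  gcongr
  linarith [Nat.lt_floor_add_one (p * M)]

/-- A discretized degree-`d` network: for each node a list of `d` parents, padded arbitrarily, and
a table of conditional probabilities in `{0, 1/M, …, 1}`. The probabilities of the two values of a
bit are rounded separately, and the graph may have cycles. -/
abbrev NetCode (n d M : ℕ) : Type :=
  Fin n → (Fin d → Fin n) × ((Fin d → Bool) × Bool → Fin (M + 1))

/-- The product of conditional probabilities described by a `NetCode`, in general not a
distribution. -/
def NetCode.eval {n d M : ℕ} (c : NetCode n d M) (x : Cube n) : ℝ :=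
  ∏ i, ((c i).2 (fun j ↦ x ((c i).1 j), x i) : ℕ) / M

lemma exists_enumeration {β : Type*} [Finite β] {d : ℕ} {s : Set β} (hs : s.ncard ≤ d) (b : β) :
    ∃ (σ : Fin d → β) (e : s → Fin d), ∀ j, σ (e j) = j := by
  have := Fintype.ofFinite s
  obtain ⟨e⟩ := Function.Embedding.nonempty_of_card_le (α := s) (β := Fin d)
    (by rwa [Fintype.card_fin, ← Nat.card_eq_fintype_card, Nat.card_coe_set_eq])
  exact ⟨Function.extend e Subtype.val fun _ ↦ b, e, e.injective.extend_apply _ _⟩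

lemma IsBayesNet.exists_netCode {n d M : ℕ} (hM : 0 < M) {P : PMF (Cube n)}
    (hP : IsBayesNet d P) : ∃ c : NetCode n d M, ∀ x, |(P x).toReal - c.eval x| ≤ n / M := by
  obtain ⟨G, -, hdeg, p, hp⟩ := hP
  choose σ e hσ using fun i ↦ exists_enumeration (hdeg i) i
  have hmem (i : Fin n) (u : Fin d → Bool) (b : Bool) :
      (p i (u ∘ e i) b).toReal ∈ Set.Icc 0 1 := ⟨ENNReal.toReal_nonneg, toReal_pmf_le_one _ _⟩
  choose t ht using fun i u b ↦ exists_abs_sub_div_le hM (hmem i u b)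
  refine ⟨fun i ↦ (σ i, fun ub ↦ t i ub.1 ub.2), fun x ↦ ?_⟩
  have hfactor (i : Fin n) :
      |(p i (fun j ↦ x j) (x i)).toReal - (t i (fun j ↦ x (σ i j)) (x i) : ℕ) / M| ≤ 1 / M := by
    simpa [Function.comp_def, hσ] using ht i (fun j ↦ x (σ i j)) (x i)
  have hgrid (k : Fin (M + 1)) : ‖((k : ℕ) / M : ℝ)‖ ≤ 1 := by
    rw [Real.norm_of_nonneg (by positivity)]
    exact div_le_one_of_le₀ (Nat.cast_le.2 k.is_le) (by positivity)
  calc _ = ‖∏ i, (p i (fun j ↦ x j) (x i)).toReal -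
          ∏ i, ((t i (fun j ↦ x (σ i j)) (x i) : ℕ) / M : ℝ)‖ := by
        rw [hp, ENNReal.toReal_prod, Real.norm_eq_abs]
        rfl
    _ ≤ ∑ i : Fin n, (1 / M : ℝ) :=
        (norm_prod_sub_prod_le
          (fun i _ ↦ (Real.norm_of_nonneg ENNReal.toReal_nonneg).trans_le
            (toReal_pmf_le_one _ _)) fun i _ ↦ hgrid _).trans
          (Finset.sum_le_sum fun i _ ↦ hfactor i)
    _ = n / M := by simp [div_eq_mul_inv]

lemma exists_finset_net_of_codes {α C : Type*} [Fintype α] [Fintype C] (eval : C → α → ℝ)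
    {S : Set (PMF α)} {δ : ℝ} (hS : ∀ P ∈ S, ∃ c, ∀ x, |(P x).toReal - eval c x| ≤ δ) :
    ∃ F : Finset (PMF α), F.card ≤ Fintype.card C ∧
      ∀ P ∈ S, ∃ Q ∈ F, tvDist P Q ≤ Fintype.card α * δ := by
  classical
  rcases S.eq_empty_or_nonempty with rfl | ⟨P₀, -⟩
  · exact ⟨∅, by simp⟩
  have hrep (c : C) : ∃ Q : PMF α, (∃ P ∈ S, ∀ x, |(P x).toReal - eval c x| ≤ δ) →
      ∀ x, |(Q x).toReal - eval c x| ≤ δ := by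
    by_cases h : ∃ P ∈ S, ∀ x, |(P x).toReal - eval c x| ≤ δ
    · exact ⟨h.choose, fun _ ↦ h.choose_spec.2⟩
    · exact ⟨P₀, fun h' ↦ absurd h' h⟩
  choose rep hrep using hrep
  refine ⟨Finset.univ.image rep, Finset.card_image_le, fun P hP ↦ ?_⟩
  obtain ⟨c, hc⟩ := hS P hP
  refine ⟨rep c, Finset.mem_image_of_mem _ (Finset.mem_univ c), ?_⟩
  have hterm (x : α) : |(P x).toReal - (rep c x).toReal| ≤ 2 * δ := by
    have h := abs_sub_le (P x).toReal (eval c x) (rep c x).toReal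
    rw [abs_sub_comm (eval c x)] at h
    linarith [hc x, hrep c ⟨P, hP, hc⟩ x]
  calc tvDist P (rep c) ≤ 1 / 2 * ∑ _x : α, 2 * δ := by
        unfold tvDist
        gcongr with x
        exact hterm x
    _ = Fintype.card α * δ := by
        rw [Finset.sum_const, Finset.card_univ, nsmul_eq_mul]
        ring

lemma card_netCode_le {n d M : ℕ} {L : ℝ} (hM : ((M + 1 : ℕ) : ℝ) ≤ Real.exp (4 * n + L)) :
    (Fintype.card (NetCode n d M) : ℝ) ≤ Real.exp (n * 2 ^ d * (9 * n + 2 * L)) := by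
  have hparents : (n : ℝ) ^ d ≤ Real.exp (2 ^ d * n) := by
    have hn : (n : ℝ) ≤ Real.exp n := by linarith [Real.add_one_le_exp (n : ℝ)]
    calc (n : ℝ) ^ d ≤ Real.exp n ^ d := by gcongr
      _ = Real.exp (d * n) := (Real.exp_nat_mul _ _).symm
      _ ≤ Real.exp (2 ^ d * n) := by
        gcongr
        exact_mod_cast Nat.lt_two_pow_self.le
  have htable : ((M + 1 : ℕ) : ℝ) ^ (2 ^ d * 2) ≤ Real.exp (2 ^ d * 2 * (4 * n + L)) :=
    (pow_le_pow_left₀ (by positivity) hM _).trans_eq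
      (by rw [← Real.exp_nat_mul]; push_cast; rfl)
  calc (Fintype.card (NetCode n d M) : ℝ)
      = ((n : ℝ) ^ d * ((M + 1 : ℕ) : ℝ) ^ (2 ^ d * 2)) ^ n := by simp
    _ ≤ (Real.exp (2 ^ d * n) * Real.exp (2 ^ d * 2 * (4 * n + L))) ^ n := by gcongr
    _ = Real.exp (n * 2 ^ d * (9 * n + 2 * L)) := by
        rw [← Real.exp_add, ← Real.exp_nat_mul]
        ring_nf

theorem exists_finset_net_bayesNet {n : ℕ} (d : ℕ) (hn : 0 < n) {δ : ℝ} (hδ0 : 0 < δ)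
    (hδ1 : δ ≤ 1) :
    ∃ F : Finset (PMF (Cube n)),
      (F.card : ℝ) ≤ Real.exp (n * 2 ^ d * (9 * n + 2 * Real.log δ⁻¹)) ∧
      ∀ P, IsBayesNet d P → ∃ Q ∈ F, tvDist P Q ≤ δ := by
  have hn1 : (1 : ℝ) ≤ n := Nat.one_le_cast.2 hn
  set N : ℝ := 2 ^ n * n / δ with hN
  have hN1 : 1 ≤ N := by
    rw [hN, one_le_div hδ0]
    exact hδ1.trans (one_le_mul_of_one_le_of_one_le (one_le_pow₀ one_le_two) hn1)
  have hM : 0 < ⌈N⌉₊ := Nat.ceil_pos.2 (by linarith)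
  obtain ⟨F, hcard, hF⟩ := exists_finset_net_of_codes NetCode.eval
    fun P (hP : IsBayesNet d P) ↦ hP.exists_netCode hM
  refine ⟨F, (Nat.cast_le.2 hcard).trans (card_netCode_le ?_), fun P hP ↦ ?_⟩
  · have h2 : (2 : ℝ) ^ n ≤ Real.exp n := by
      rw [← Real.exp_one_pow]
      gcongr
      linarith [Real.add_one_le_exp 1]
    have h3 : 3 ≤ Real.exp (2 * n) := by linarith [Real.add_one_le_exp (2 * n : ℝ)]
    calc ((⌈N⌉₊ + 1 : ℕ) : ℝ) ≤ 3 * N := by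
          push_cast
          linarith [Nat.ceil_lt_add_one (zero_le_one.trans hN1)]
      _ = 3 * 2 ^ n * n * δ⁻¹ := by
          rw [hN]
          ring
      _ ≤ Real.exp (2 * n) * Real.exp n * Real.exp n * δ⁻¹ := by
          gcongr
          linarith [Real.add_one_le_exp (n : ℝ)]
      _ = Real.exp (4 * n + Real.log δ⁻¹) := by
          rw [Real.exp_add, Real.exp_log (inv_pos.2 hδ0), ← Real.exp_add, ← Real.exp_add]
          ring_nf
  · obtain ⟨Q, hQF, hQ⟩ := hF P hP
    refine ⟨Q, hQF, hQ.trans ?_⟩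
    rw [Fintype.card_fun, Fintype.card_bool, Fintype.card_fin, Nat.cast_pow, Nat.cast_ofNat,
      mul_div_assoc', div_le_iff₀ (Nat.cast_pos.2 hM), ← div_le_iff₀' hδ0]
    exact Nat.le_ceil _

lemma isBayesNet_uniformOfFintype (n d : ℕ) :
    IsBayesNet d (PMF.uniformOfFintype (Cube n)) := by
  refine ⟨⊥, fun v hv ↦ ?_, fun i ↦ ?_, fun _ _ ↦ PMF.uniformOfFintype Bool, fun x ↦ ?_⟩
  · obtain ⟨_, h⟩ := Relation.TransGen.head'_iff.1 hv
    exact h.1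
  · have : parents (⊥ : Digraph (Fin n)) i = ∅ := rfl
    simp [this]
  · simp [PMF.uniformOfFintype_apply, ENNReal.inv_pow]

end Net

section LowerBound

variable {ι κ : Type*} [Fintype ι] [Fintype κ] [Nonempty ι] [Nonempty κ] [DecidableEq κ]
  [MeasurableSpace κ] [MeasurableSingletonClass κ] {n d : ℕ} (e : Cube n ≃ ι × κ)

lemma measureReal_not_isFarFromBayesNets_le {F : Finset (PMF (Cube n))} {δ ε τ : ℝ}
    (hF : ∀ P, IsBayesNet d P → ∃ Q ∈ F, tvDist P Q ≤ δ) (a : unitInterval) (ha : 0 < a)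
    (hτ : 0 ≤ τ) (hε : ε + δ ≤ a * (1 - 1 / Fintype.card κ - τ)) :
    (uniformOn (Set.univ : Set (ι → κ))).real
        {z | ¬IsFarFromBayesNets d ε (plantedPMF e a z)} ≤
      F.card * Real.exp (-2 * τ ^ 2 * Fintype.card ι) := by
  calc _ ≤ (uniformOn (Set.univ : Set (ι → κ))).real (⋃ Q ∈ F,
          {z | tvDist (plantedPMF e a z) Q ≤ a * (1 - 1 / Fintype.card κ - τ)}) :=
        measureReal_mono (fun z hz ↦ ?_) (measure_ne_top _ _)
    _ ≤ ∑ Q ∈ F, Real.exp (-2 * τ ^ 2 * Fintype.card ι) :=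
        (measureReal_biUnion_finset_le _ _).trans
          (Finset.sum_le_sum fun Q _ ↦ measureReal_tvDist_plantedPMF_le e a ha Q hτ)
    _ = _ := by rw [Finset.sum_const, nsmul_eq_mul]
  simp only [IsFarFromBayesNets, Set.mem_ofPred_eq, not_forall, not_le] at hz
  obtain ⟨P, hP, hPε⟩ := hz
  obtain ⟨Q, hQF, hPQ⟩ := hF P hP
  refine Set.mem_biUnion hQF ?_
  rw [Set.mem_ofPred_eq]
  linarith [tvDist_triangle (plantedPMF e a z) P Q]

lemma net_mul_exp_neg_le {s N B K L : ℝ} (hK : 8 ≤ K) (hN : 1 ≤ N) (hs : 1 ≤ s) (hL : 0 ≤ L)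
    (hbudget : s * (N + L) ≤ B / (4 * K ^ 3)) :
    Real.exp (s * (9 * N + 2 * (Real.log K + L))) * Real.exp (-2 * (1 / K) ^ 2 * B) ≤ 1 / 4 := by
  have hK0 : 0 < K := by linarith
  have hlogK : Real.log K ≤ K := (Real.log_le_sub_one_of_pos hK0).trans (by linarith)
  have hnet : s * (9 * N + 2 * (Real.log K + L)) ≤ B / K ^ 2 := by
    calc s * (9 * N + 2 * (Real.log K + L)) ≤ s * (4 * K * (N + L)) := by
          gcongr
          nlinarith [mul_nonneg hK0.le hL, mul_nonneg hK0.le (sub_nonneg.2 hN)]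
      _ = 4 * K * (s * (N + L)) := by ring
      _ ≤ 4 * K * (B / (4 * K ^ 3)) := by gcongr
      _ = B / K ^ 2 := by field_simp
  have hB : 3 ≤ B / K ^ 2 := by
    have hlogK0 : 0 ≤ Real.log K := Real.log_nonneg (by linarith)
    have h3 : 3 ≤ 9 * N + 2 * (Real.log K + L) := by linarith
    exact h3.trans ((le_mul_of_one_le_left (by linarith) hs).trans hnet)
  have hτ : -2 * (1 / K) ^ 2 * B = -(2 * (B / K ^ 2)) := by field_simp
  rw [← Real.exp_add, hτ]
  calc _ ≤ Real.exp (-(B / K ^ 2)) := by gcongr; linarith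
    _ ≤ 1 / 4 := by
        rw [Real.exp_neg, ← one_div]
        gcongr
        linarith [Real.add_one_le_exp (B / K ^ 2)]

theorem exists_three_fourths_le_isFarFromBayesNets (hn : 0 < n) (hκ : 8 ≤ Fintype.card κ)
    {ε : ℝ} (hε0 : 0 < ε) (hε1 : ε ≤ 1 - 4 / Fintype.card κ)
    (hbudget : n * 2 ^ d * (n + Real.log ε⁻¹) ≤
      Fintype.card ι / (4 * (Fintype.card κ : ℝ) ^ 3)) :
    ∃ a : unitInterval, a ≤ 2 * ε ∧ 3 / 4 ≤ (uniformOn (Set.univ : Set (ι → κ))).real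
      {z | IsFarFromBayesNets d ε (plantedPMF e a z)} := by
  set K : ℝ := (Fintype.card κ : ℝ)
  have hK : 8 ≤ K := Nat.ofNat_le_cast.2 hκ
  have hK0 : 0 < K := by linarith
  have hKinv : 4 / K ≤ 1 / 2 := by
    rw [div_le_div_iff₀ hK0 two_pos]
    linarith
  have hε_lt : ε ≤ 1 := hε1.trans (sub_le_self _ (by positivity))
  have hgap : 0 < 1 - 4 / K := by linarith
  set a : unitInterval := ⟨ε / (1 - 4 / K), by positivity, div_le_one_of_le₀ hε1 hgap.le⟩ with ha
  have ha2 : (a : ℝ) ≤ 2 * ε := by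
    rw [ha, div_le_iff₀ hgap]
    nlinarith
  have ha0 : 0 < a := Subtype.coe_lt_coe.1 (div_pos hε0 hgap)
  have hmargin : ε + ε / K ≤ a * (1 - 1 / K - 1 / K) := by
    rw [ha, div_mul_eq_mul_div, le_div_iff₀ hgap]
    field_simp
    nlinarith
  obtain ⟨F, hFcard, hF⟩ := exists_finset_net_bayesNet d hn (δ := ε / K) (by positivity)
    (div_le_one_of_le₀ (by linarith) hK0.le)
  refine ⟨a, ha2, ?_⟩
  have hfail := measureReal_not_isFarFromBayesNets_le e hF a ha0 (by positivity) hmargin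
  have hsmall : F.card * Real.exp (-2 * (1 / K) ^ 2 * Fintype.card ι) ≤ 1 / 4 := by
    refine le_trans ?_ (net_mul_exp_neg_le hK (Nat.one_le_cast.2 hn) ?_ ?_ hbudget)
    · gcongr
      rwa [inv_div, div_eq_mul_inv, Real.log_mul hK0.ne' (inv_pos.2 hε0).ne'] at hFcard
    · exact one_le_mul_of_one_le_of_one_le (Nat.one_le_cast.2 hn) (one_le_pow₀ one_le_two)
    · exact Real.log_nonneg ((one_le_inv₀ hε0).2 hε_lt)
  have hcompl := probReal_add_probReal_compl (μ := uniformOn (Set.univ : Set (ι → κ)))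
    (s := {z | IsFarFromBayesNets d ε (plantedPMF e a z)}) (Set.toFinite _).measurableSet
  rw [Set.compl_ofPred] at hcompl
  linarith

end LowerBound

theorem two_pow_le_of_rejects_far {j k d m : ℕ} {T : (Fin m → Cube (j + k)) → PMF Bool}
    (hk : 3 ≤ k) {ε : ℝ} (hε0 : 0 < ε) (hε1 : ε ≤ 1 - 4 / 2 ^ k)
    (hbudget : (j + k : ℕ) * 2 ^ d * ((j + k : ℕ) + Real.log ε⁻¹) ≤ 2 ^ j / (4 * (2 ^ k) ^ 3))
    (huniform : 2 / 3 ≤ (outputLaw T (PMF.uniformOfFintype (Cube (j + k))) true).toReal)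
    (hfar : ∀ P, IsFarFromBayesNets d ε P → 2 / 3 ≤ (outputLaw T P false).toReal) :
    (2 : ℝ) ^ j ≤ 80 * m ^ 2 * ε ^ 4 * (2 ^ k) ^ 2 := by
  have hcard (l : ℕ) : (Fintype.card (Cube l) : ℝ) = 2 ^ l := by simp
  have hcard_ge : 8 ≤ Fintype.card (Cube k) := by
    simpa using Nat.pow_le_pow_right two_pos hk
  set e : Cube (j + k) ≃ Cube j × Cube k := (Fin.appendEquiv j k).symm
  rw [← hcard k] at hε1 ⊢
  rw [← hcard j, ← hcard k] at hbudget
  rw [← hcard j]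
  obtain ⟨a, haε, hprob⟩ := exists_three_fourths_le_isFarFromBayesNets e
    (by lia) hcard_ge hε0 hε1 hbudget
  have ha := unitInterval.nonneg a
  have hbound := card_le_of_distinguishes e a huniform
    (hprob.trans (measureReal_mono fun z hz ↦ hfar _ hz))
  calc (Fintype.card (Cube j) : ℝ) ≤ 5 * m ^ 2 * a ^ 4 * Fintype.card (Cube k) ^ 2 := hbound
    _ ≤ 5 * m ^ 2 * (2 * ε) ^ 4 * Fintype.card (Cube k) ^ 2 := by gcongr
    _ = 80 * m ^ 2 * ε ^ 4 * Fintype.card (Cube k) ^ 2 := by ring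

lemma le_of_budget_le {n k d : ℕ} {L : ℝ} (hn : 0 < n) (hL : 0 ≤ L)
    (hbudget : n * 2 ^ d * (n + L) ≤ 1 / (4 * (2 ^ k) ^ 4) * 2 ^ n) : k ≤ n := by
  have hn1 : (1 : ℝ) ≤ n := Nat.one_le_cast.2 hn
  have hK : (1 : ℝ) ≤ 2 ^ k := one_le_pow₀ one_le_two
  have hone : 1 ≤ n * 2 ^ d * (n + L) :=
    one_le_mul_of_one_le_of_one_le
      (one_le_mul_of_one_le_of_one_le hn1 (one_le_pow₀ one_le_two)) (by linarith)
  have hKn := hone.trans hbudget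
  rw [one_div_mul_eq_div, one_le_div (by positivity)] at hKn
  refine (pow_le_pow_iff_right₀ (one_lt_two (α := ℝ))).1 ?_
  linarith [le_self_pow₀ hK four_ne_zero]

theorem two_rpow_half_div_sq_le_of_rejects_far {n k d m : ℕ} {T : (Fin m → Cube n) → PMF Bool}
    (hn : 0 < n) (hk : 3 ≤ k) {ε : ℝ} (hε0 : 0 < ε) (hε1 : ε ≤ 1 - 4 / 2 ^ k)
    (hbudget : n * 2 ^ d * (n + Real.log ε⁻¹) ≤ 1 / (4 * (2 ^ k) ^ 4) * 2 ^ n)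
    (huniform : 2 / 3 ≤ (outputLaw T (PMF.uniformOfFintype (Cube n)) true).toReal)
    (hfar : ∀ P, IsFarFromBayesNets d ε P → 2 / 3 ≤ (outputLaw T P false).toReal) :
    1 / (4 * (2 ^ k) ^ 4) * ((2 : ℝ) ^ ((n : ℝ) / 2) / ε ^ 2) ≤ m := by
  have hε_le : ε ≤ 1 := hε1.trans (sub_le_self _ (by positivity))
  obtain ⟨j, rfl⟩ := Nat.exists_eq_add_of_le'
    (le_of_budget_le hn (Real.log_nonneg ((one_le_inv₀ hε0).2 hε_le)) hbudget)
  have hbound := two_pow_le_of_rejects_far hk hε0 hε1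
    (hbudget.trans_eq (by rw [pow_add]; field_simp)) huniform hfar
  have hK : (8 : ℝ) ≤ 2 ^ k :=
    le_of_eq_of_le (by norm_num) (pow_le_pow_right₀ one_le_two hk)
  set K : ℝ := 2 ^ k
  rw [mul_div_assoc', div_le_iff₀ (by positivity)]
  refine le_of_sq_le_sq ?_ (by positivity)
  have hsqrt : ((2 : ℝ) ^ (((j + k : ℕ) : ℝ) / 2)) ^ 2 = 2 ^ j * K := by
    rw [← Real.rpow_mul_natCast two_pos.le, Nat.cast_two, div_mul_cancel₀ _ two_ne_zero,
      Real.rpow_natCast, pow_add]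
  calc (1 / (4 * K ^ 4) * (2 : ℝ) ^ (((j + k : ℕ) : ℝ) / 2)) ^ 2
      = (1 / (4 * K ^ 4)) ^ 2 * (2 ^ j * K) := by rw [mul_pow, hsqrt]
    _ ≤ (1 / (4 * K ^ 4)) ^ 2 * (80 * m ^ 2 * ε ^ 4 * K ^ 2 * K) := by gcongr
    _ = 5 / K ^ 5 * (m * ε ^ 2) ^ 2 := by
        field_simp
        ring
    _ ≤ (m * ε ^ 2) ^ 2 := by
        refine mul_le_of_le_one_left (by positivity) (div_le_one_of_le₀ ?_ (by positivity))
        linarith [le_self_pow₀ (by linarith : 1 ≤ K) (by norm_num : 5 ≠ 0)]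

theorem corollaryB2_general (η : ℝ) (hη : 0 < η) :
    ∃ c : ℝ, 0 < c ∧ ∀ (n d : ℕ) (ε : ℝ), 0 < n → 0 < ε → ε ≤ 1 - η →
      n * 2 ^ d * (n + Real.log ε⁻¹) ≤ c * 2 ^ n →
      ∀ (m : ℕ) (T : (Fin m → Cube n) → PMF Bool),
        2 / 3 ≤ (outputLaw T (PMF.uniformOfFintype (Cube n)) true).toReal →
        (∀ P, IsFarFromBayesNets d ε P → 2 / 3 ≤ (outputLaw T P false).toReal) →
        c * ((2 : ℝ) ^ ((n : ℝ) / 2) / ε ^ 2) ≤ m := by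
  obtain ⟨l, hl⟩ := pow_unbounded_of_one_lt η⁻¹ (one_lt_two (α := ℝ))
  have hgap : 4 / 2 ^ (l + 3) ≤ η := by
    rw [div_le_iff₀ (by positivity), pow_add]
    linarith [(inv_lt_iff_one_lt_mul₀' hη).1 hl]
  exact ⟨1 / (4 * (2 ^ (l + 3)) ^ 4), by positivity,
    fun n d ε hn hε0 hε1 hbudget m T huniform hfar ↦
      two_rpow_half_div_sq_le_of_rejects_far hn (Nat.le_add_left 3 l) hε0
        (hε1.trans (sub_le_sub_left hgap 1)) hbudget huniform hfar⟩

lemma isLittleO_natCast_pow_mul_pow {d : ℕ → ℕ}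
    (hd : (fun n ↦ (d n : ℝ)) =o[atTop] fun n : ℕ ↦ (n : ℝ)) (j : ℕ) {r : ℝ} (hr : 1 < r) :
    (fun n : ℕ ↦ (n : ℝ) ^ j * r ^ d n) =o[atTop] fun n ↦ r ^ n := by
  have hsqrt : 1 < √r := Real.lt_sqrt_of_sq_lt (by simpa)
  have hsq (n : ℕ) : r ^ n = √r ^ n * √r ^ n := by
    rw [← mul_pow, Real.mul_self_sqrt (by linarith)]
  have hexp : (fun n ↦ r ^ d n) =O[atTop] fun n ↦ √r ^ n := by
    refine IsBigO.of_bound 1 ?_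
    filter_upwards [hd.bound one_half_pos] with n hn
    rw [Real.norm_natCast, Real.norm_natCast] at hn
    have hdn : d n + d n ≤ n := by
      rify
      linarith
    rw [hsq, ← pow_add, one_mul, norm_pow, norm_pow]
    exact pow_le_pow_right₀ (hsqrt.le.trans (le_abs_self _)) hdn
  simpa only [hsq] using (isLittleO_pow_const_const_pow_of_one_lt j hsqrt).mul_isBigO hexp

lemma eventually_budget_le {c : ℝ} (hc : 0 < c) (A : ℝ) {d : ℕ → ℕ}
    (hd : (fun n ↦ (d n : ℝ)) =o[atTop] fun n : ℕ ↦ (n : ℝ)) :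
    ∀ᶠ n : ℕ in atTop, ∀ ε : ℝ, (2 : ℝ) ^ (-(A * n)) ≤ ε →
      n * 2 ^ d n * (n + Real.log ε⁻¹) ≤ c * 2 ^ n := by
  have hA : 0 < 1 + |A| := by positivity
  filter_upwards [(isLittleO_natCast_pow_mul_pow hd 2 one_lt_two).bound (div_pos hc hA)]
    with n hn ε hε
  rw [Real.norm_of_nonneg (by positivity), Real.norm_of_nonneg (by positivity),
    div_mul_eq_mul_div, le_div_iff₀ hA] at hn
  have hlog : Real.log ε⁻¹ ≤ |A| * n := by
    calc Real.log ε⁻¹ ≤ Real.log ((2 : ℝ) ^ (A * n)) := by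
          refine Real.log_le_log (inv_pos.2 ((by positivity : (0 : ℝ) < _).trans_le hε)) ?_
          rw [← inv_inv ((2 : ℝ) ^ (A * n)), ← Real.rpow_neg two_pos.le]
          gcongr
      _ = A * n * Real.log 2 := Real.log_rpow two_pos _
      _ ≤ |A| * n * 1 := by
          gcongr
          · exact le_abs_self A
          · linarith [Real.log_two_lt_d9]
      _ = |A| * n := mul_one _
  calc _ ≤ n * 2 ^ d n * (n + |A| * n) := by gcongr
    _ = (n : ℝ) ^ 2 * 2 ^ d n * (1 + |A|) := by ring
    _ ≤ c * 2 ^ n := hn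

end

theorem corollaryB2 (η : ℝ) (hη : 0 < η) :
    ∃ c : ℝ, 0 < c ∧
      ∀ (A : ℝ) (d : ℕ → ℕ),
        ((fun n : ℕ => (d n : ℝ)) =o[atTop] fun n : ℕ => (n : ℝ)) →
        ∀ᶠ n : ℕ in atTop, ∀ ε : ℝ, (2 : ℝ) ^ (-(A * (n : ℝ))) ≤ ε → ε ≤ 1 - η →
          ∀ (m : ℕ) (T : (Fin m → Cube n) → PMF Bool), IsBayesNetTester (d n) ε T →
            c * ((2 : ℝ) ^ ((n : ℝ) / 2) / ε ^ 2) ≤ (m : ℝ) := by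
  obtain ⟨c, hc, hbound⟩ := corollaryB2_general η hη
  refine ⟨c, hc, fun A d hd ↦ ?_⟩
  filter_upwards [eventually_gt_atTop 0, eventually_budget_le hc A hd]
    with n hn hbudget ε hε hεη m T hT
  exact hbound n (d n) ε hn ((Real.rpow_pos_of_pos two_pos _).trans_le hε) hεη (hbudget ε hε) m T
    ((hT _).1 (isBayesNet_uniformOfFintype n (d n))) fun P ↦ (hT P).2
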